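/- For every positive integer $n$ there is a latin square $L$ of order $n$ (an $n\times n$ array on $n$ symbols in which every row and every column contains each symbol exactly once) with the following property: for every cell $(i,j)$ of $L$ and every symbol $s$ there is a latin subsquare of $L$ of some order $k\le 94$ that contains the cell $(i,j)$ and the symbol $s$. Here a latin subsquare of order $k$ is the sub-array of $L$ on a set $R$ of $k$ rows and a set $C$ of $k$ columns (not necessarily contiguous, and not necessarily the same index set) that is itself a latin square on a set $S$ of $k$ symbols; that it contains the cell $(i,j)$ and the symbol $s$ means $i\in R$, $j\in C$ and $s\in S$. -/

import Mathlib

/-- An `n × n` array on `n` symbols is a latin square if every row and every column exhausts the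
symbols, with no repetition. -/
structure IsLatinSquare {n : ℕ} (L : Fin n → Fin n → Fin n) : Prop where
  row_bijective : ∀ i, Function.Bijective (L i)
  col_bijective : ∀ j, Function.Bijective (fun i => L i j)

/-- The sub-array of `L` on the (not necessarily contiguous) set of rows `R` and set of columns `C`
is a latin square of order `k` whose set of symbols is `S`. -/
structure IsLatinSubsquare {n : ℕ} (L : Fin n → Fin n → Fin n) (k : ℕ)
    (R C S : Finset (Fin n)) : Prop where
  card_rows : R.card = k
  card_cols : C.card = k
  card_symbols : S.card = k
  row_bijOn : ∀ i ∈ R, Set.BijOn (L i) (C : Set (Fin n)) (S : Set (Fin n))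
  col_bijOn : ∀ j ∈ C, Set.BijOn (fun i => L i j) (R : Set (Fin n)) (S : Set (Fin n))

/-! Work in affine space over the field of seven elements, and let `7 ^ d ≤ n < 7 ^ (d + 1)`. Two
constructions cover the two ends of this range; the subsquares they give have order at most 49.

If `n ≥ 3 * 7 ^ d`, some `n`-point set `X` in dimension `d + 1` meets no line in exactly two points.
Each line through two points of `X` then carries an idempotent latin square on its trace, and these
squares glue to one on `X`. The trace of an affine plane is closed under it, and any row, column and
symbol lie in a plane (`NoTwoSecant.coveredLatin`).

If `n < 3 * 7 ^ d`, write `n - 7 ^ d` as a sum of the sizes of four such sets in dimension `d`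
(`isFourSum_of_le`). Prolong the addition table of `V = (ZMod 7) ^ d` by them along four families of
parallel transversals (`coveredLatin_add`). Cosets of a one-dimensional subspace give subsquares of
order at most `5 * 7`; a row, column and symbol all in the same adjoined set are covered by a plane
inside that set. -/

/-- `CoveredLatin n` says that there is a latin square of order `n` in which every cell and symbol
lie in a common subsquare of order at most `94`. -/
def CoveredLatin (n : ℕ) : Prop :=
  ∃ L : Fin n → Fin n → Fin n, IsLatinSquare L ∧
    ∀ i j s : Fin n, ∃ (k : ℕ) (R C S : Finset (Fin n)),
      k ≤ 94 ∧ IsLatinSubsquare L k R C S ∧ i ∈ R ∧ j ∈ C ∧ s ∈ S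

/-! ### Latin squares on finite sets -/

/-- `f` restricts to a latin square on the finite set `A`. -/
structure LatinOn {α : Type*} (f : α → α → α) (A : Finset α) : Prop where
  mem : ∀ a ∈ A, ∀ b ∈ A, f a b ∈ A
  left_inj : ∀ a ∈ A, ∀ b ∈ A, ∀ c ∈ A, f a b = f a c → b = c
  right_inj : ∀ a ∈ A, ∀ b ∈ A, ∀ c ∈ A, f a c = f b c → a = b

/-- Closure of the sub-array suffices: each of its rows and columns maps injectively between sets of
equal size, hence bijectively. -/
theorem CoveredLatin.of_fintype {P : Type*} [Fintype P] (f : P → P → P)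
    (hl : ∀ a, Function.Injective (f a)) (hr : ∀ b, Function.Injective fun a => f a b)
    (hsub : ∀ i j s, ∃ R C S : Finset P, R.card ≤ 94 ∧ C.card = R.card ∧ S.card = R.card ∧
      (∀ r ∈ R, ∀ c ∈ C, f r c ∈ S) ∧ i ∈ R ∧ j ∈ C ∧ s ∈ S) :
    CoveredLatin (Fintype.card P) := by
  classical
  let e := Fintype.equivFin P
  refine ⟨fun i j => e (f (e.symm i) (e.symm j)), ⟨fun i => ?_, fun j => ?_⟩, fun i j s => ?_⟩
  · exact Finite.injective_iff_bijective.1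
      (e.injective.comp ((hl _).comp e.symm.injective))
  · exact Finite.injective_iff_bijective.1
      (e.injective.comp ((hr (e.symm j)).comp e.symm.injective))
  · obtain ⟨R, C, S, hk, hC, hS, hm, hi, hj, hs⟩ := hsub (e.symm i) (e.symm j) (e.symm s)
    refine ⟨R.card, R.map e.toEmbedding, C.map e.toEmbedding, S.map e.toEmbedding, hk,
      ⟨by simp, by simp [hC], by simp [hS], ?_, ?_⟩, by simpa using hi, by simpa using hj,
      by simpa using hs⟩
    · intro r hr'
      have hmaps : Set.MapsTo (fun j => e (f (e.symm r) (e.symm j)))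
          (C.map e.toEmbedding : Finset _) (S.map e.toEmbedding : Finset _) := by
        intro c hc
        simp only [Finset.mem_coe, Finset.mem_map_equiv, Equiv.symm_apply_apply] at hr' hc ⊢
        exact hm _ hr' _ hc
      have hinj : Set.InjOn (fun j => e (f (e.symm r) (e.symm j)))
          (C.map e.toEmbedding : Finset _) :=
        (e.injective.comp ((hl _).comp e.symm.injective)).injOn
      exact ⟨hmaps, hinj, Finset.surjOn_of_injOn_of_card_le _ hmaps hinj (by simp [hC, hS])⟩
    · intro c hc'
      have hmaps : Set.MapsTo (fun i => e (f (e.symm i) (e.symm c)))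
          (R.map e.toEmbedding : Finset _) (S.map e.toEmbedding : Finset _) := by
        intro r hr
        simp only [Finset.mem_coe, Finset.mem_map_equiv, Equiv.symm_apply_apply] at hc' hr ⊢
        exact hm _ hr _ hc'
      have hinj : Set.InjOn (fun i => e (f (e.symm i) (e.symm c)))
          (R.map e.toEmbedding : Finset _) :=
        (e.injective.comp ((hr (e.symm c)).comp e.symm.injective)).injOn
      exact ⟨hmaps, hinj, Finset.surjOn_of_injOn_of_card_le _ hmaps hinj (by simp [hS])⟩

theorem CoveredLatin.of_latinOn {α : Type*} (f : α → α → α) (A : Finset α)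
    (hf : LatinOn f A)
    (hsub : ∀ i ∈ A, ∀ j ∈ A, ∀ s ∈ A, ∃ R C S : Finset α, R ⊆ A ∧ C ⊆ A ∧ S ⊆ A ∧
      R.card ≤ 94 ∧ C.card = R.card ∧ S.card = R.card ∧
      (∀ r ∈ R, ∀ c ∈ C, f r c ∈ S) ∧ i ∈ R ∧ j ∈ C ∧ s ∈ S) :
    CoveredLatin A.card := by
  classical
  rw [← Fintype.card_coe A]
  refine CoveredLatin.of_fintype (P := A) (fun a b => ⟨f a b, hf.mem _ a.2 _ b.2⟩) ?_ ?_ ?_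
  · intro a b c h
    exact Subtype.ext (hf.left_inj _ a.2 _ b.2 _ c.2 (congrArg Subtype.val h))
  · intro c a b h
    exact Subtype.ext (hf.right_inj _ a.2 _ b.2 _ c.2 (congrArg Subtype.val h))
  · intro i j s
    obtain ⟨R, C, S, hRA, hCA, hSA, hk, hC, hS, hm, hi, hj, hs⟩ := hsub _ i.2 _ j.2 _ s.2
    have key : ∀ B ⊆ A, (B.subtype (· ∈ A)).card = B.card := fun B hB => by
      rw [Finset.card_subtype, Finset.filter_true_of_mem hB]
    refine ⟨R.subtype (· ∈ A), C.subtype (· ∈ A), S.subtype (· ∈ A), ?_, ?_, ?_, ?_,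
      by simpa using hi, by simpa using hj, by simpa using hs⟩
    · rwa [key R hRA]
    · rw [key R hRA, key C hCA, hC]
    · rw [key R hRA, key S hSA, hS]
    · intro r hr c hc
      simp only [Finset.mem_subtype] at hr hc ⊢
      exact hm _ hr _ hc

/-- For odd `k` the midpoint `(a + b) / 2` modulo `k` works; orders 4 and 6 need explicit tables.
Order 2 admits no idempotent latin square, which is why two-secants are forbidden later. -/
theorem LatinOn.exists_idempotent_fin :
    ∀ k : ℕ, k ≤ 7 → k ≠ 2 → ∃ g : Fin k → Fin k → Fin k,
      (∀ a, g a a = a) ∧ (∀ a b c, g a b = g a c → b = c) ∧ ∀ a b c, g a c = g b c → a = b := by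
  intro k hk h2
  obtain rfl | rfl | rfl | rfl | rfl | rfl | rfl : k = 0 ∨ k = 1 ∨ k = 3 ∨ k = 4 ∨ k = 5 ∨
    k = 6 ∨ k = 7 := by omega
  · exact ⟨fun a _ => a, by decide⟩
  · exact ⟨fun a _ => a, by decide⟩
  · exact ⟨fun a b => 2 * a + 2 * b, by decide⟩
  · exact ⟨![![0, 2, 3, 1], ![3, 1, 0, 2], ![1, 3, 2, 0], ![2, 0, 1, 3]], by decide⟩
  · exact ⟨fun a b => 3 * a + 3 * b, by decide⟩
  · exact ⟨![![0, 2, 1, 4, 5, 3], ![2, 1, 3, 5, 0, 4], ![4, 5, 2, 0, 3, 1], ![1, 4, 5, 3, 2, 0], ![5, 3, 0, 1, 4, 2], ![3, 0, 4, 2, 1, 5]], by decide⟩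
  · exact ⟨fun a b => 4 * a + 4 * b, by decide⟩

theorem LatinOn.exists_idempotent {α : Type*} (A : Finset α) (h7 : A.card ≤ 7)
    (h2 : A.card ≠ 2) : ∃ g : α → α → α, LatinOn g A ∧ ∀ a ∈ A, g a a = a := by
  classical
  obtain ⟨g, hid, hl, hr⟩ := LatinOn.exists_idempotent_fin A.card h7 h2
  let e := A.equivFin
  have hg : ∀ a (ha : a ∈ A) b (hb : b ∈ A),
      (if h : a ∈ A ∧ b ∈ A then ((e.symm (g (e ⟨a, h.1⟩) (e ⟨b, h.2⟩)) : A) : α) else a) =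
        (e.symm (g (e ⟨a, ha⟩) (e ⟨b, hb⟩)) : A) := fun a ha b hb => dif_pos ⟨ha, hb⟩
  refine ⟨fun a b => if h : a ∈ A ∧ b ∈ A then
    ((e.symm (g (e ⟨a, h.1⟩) (e ⟨b, h.2⟩)) : A) : α) else a, ⟨?_, ?_, ?_⟩, ?_⟩
  · intro a ha b hb
    rw [hg a ha b hb]
    exact Subtype.property _
  · intro a ha b hb c hc h
    rw [hg a ha b hb, hg a ha c hc] at h
    exact congrArg Subtype.val (e.injective (hl _ _ _ (e.symm.injective (Subtype.ext h))))
  · intro a ha b hb c hc h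
    rw [hg a ha c hc, hg b hb c hc] at h
    exact congrArg Subtype.val (e.injective (hr _ _ _ (e.symm.injective (Subtype.ext h))))
  · intro a ha
    refine (hg a ha a ha).trans ?_
    rw [hid, Equiv.symm_apply_apply]

/-! ### Squares on sets without two-secants -/

/-- No line of the `ZMod 7`-vector space `V` meets `X` in exactly two points. -/
def NoTwoSecant {V : Type*} [AddCommGroup V] [Module (ZMod 7) V] (X : Finset V) : Prop :=
  ∀ x ∈ X, ∀ y ∈ X, x ≠ y → ∃ c : ZMod 7, c ≠ 0 ∧ c ≠ 1 ∧ x + c • (y - x) ∈ X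

instance fact_prime_seven : Fact (Nat.Prime 7) := ⟨by norm_num⟩

section Line

variable {V : Type*} [AddCommGroup V] [Module (ZMod 7) V]

open Classical in
/-- The points of `X` on the line through `x` and `y`. -/
noncomputable def lineTrace (X : Finset V) (x y : V) : Finset V :=
  X.filter fun z => ∃ c : ZMod 7, z = x + c • (y - x)

theorem mem_lineTrace {X : Finset V} {x y z : V} :
    z ∈ lineTrace X x y ↔ z ∈ X ∧ ∃ c : ZMod 7, z = x + c • (y - x) := by
  classical
  simp [lineTrace]

theorem left_mem_lineTrace {X : Finset V} {x : V} (hx : x ∈ X) (y : V) : x ∈ lineTrace X x y :=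
  mem_lineTrace.2 ⟨hx, 0, by simp⟩

theorem right_mem_lineTrace {X : Finset V} {y : V} (x : V) (hy : y ∈ X) : y ∈ lineTrace X x y :=
  mem_lineTrace.2 ⟨hy, 1, by simp⟩

theorem lineTrace_eq {X : Finset V} {x y z w : V} (hz : z ∈ lineTrace X x y)
    (hw : w ∈ lineTrace X x y) (hzw : z ≠ w) : lineTrace X z w = lineTrace X x y := by
  obtain ⟨-, a, rfl⟩ := mem_lineTrace.1 hz
  obtain ⟨-, b, rfl⟩ := mem_lineTrace.1 hw
  have hab : b - a ≠ 0 := by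
    rintro h
    exact hzw (by rw [sub_eq_zero.1 h])
  ext u
  rw [mem_lineTrace, mem_lineTrace]
  refine and_congr_right fun _ => ⟨?_, ?_⟩
  · rintro ⟨c, rfl⟩
    exact ⟨a + c * (b - a), by module⟩
  · rintro ⟨c, rfl⟩
    refine ⟨(c - a) * (b - a)⁻¹, ?_⟩
    have : c • (y - x) = a • (y - x) + ((c - a) * (b - a)⁻¹ * (b - a)) • (y - x) := by
      rw [mul_assoc, inv_mul_cancel₀ hab]
      module
    rw [this]
    module

theorem card_lineTrace_le (X : Finset V) (x y : V) : (lineTrace X x y).card ≤ 7 := by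
  classical
  have : lineTrace X x y ⊆ (Finset.univ : Finset (ZMod 7)).image fun c => x + c • (y - x) := by
    intro z hz
    obtain ⟨-, c, rfl⟩ := mem_lineTrace.1 hz
    exact Finset.mem_image_of_mem _ (Finset.mem_univ c)
  exact (Finset.card_le_card this).trans (Finset.card_image_le.trans (by simp [ZMod.card]))

theorem NoTwoSecant.card_lineTrace_ne {X : Finset V} (hX : NoTwoSecant X) {x y : V}
    (hx : x ∈ X) (hy : y ∈ X) (hxy : x ≠ y) : (lineTrace X x y).card ≠ 2 := by
  obtain ⟨c, h0, h1, hc⟩ := hX x hx y hy hxy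
  have hd : y - x ≠ 0 := sub_ne_zero.2 hxy.symm
  have : 2 < (lineTrace X x y).card := by
    rw [Finset.two_lt_card]
    refine ⟨x, left_mem_lineTrace hx y, y, right_mem_lineTrace x hy, _,
      mem_lineTrace.2 ⟨hc, c, rfl⟩, hxy, ?_, ?_⟩
    · simp [h0, hd]
    · intro h
      have : (1 - c) • (y - x) = 0 := by
        rw [sub_smul, one_smul, sub_eq_zero, sub_eq_iff_eq_add']
        exact h
      rcases smul_eq_zero.1 this with h | h
      · exact h1 (sub_eq_zero.1 h).symm
      · exact hd h
  omega

/-- A set without two-secants carries an idempotent latin square for which its intersections with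
affine subspaces are closed. -/
theorem NoTwoSecant.exists_latinOn {X : Finset V} (hX : NoTwoSecant X) :
    ∃ f : V → V → V, LatinOn f X ∧ (∀ x, f x x = x) ∧
      ∀ x ∈ X, ∀ y ∈ X, ∃ c : ZMod 7, f x y = x + c • (y - x) := by
  classical
  -- The square is chosen as a function of the trace alone, so all pairs of points on one line use
  -- the same square. The projection is a junk value for sets of unsuitable size.
  have hex : ∀ A : Finset V, ∃ g : V → V → V, A.card ≤ 7 → A.card ≠ 2 →
      LatinOn g A ∧ ∀ a ∈ A, g a a = a := by
    intro A
    by_cases h : A.card ≤ 7 ∧ A.card ≠ 2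
    · obtain ⟨g, hg⟩ := LatinOn.exists_idempotent A h.1 h.2
      exact ⟨g, fun _ _ => hg⟩
    · exact ⟨fun a _ => a, fun h1 h2 => absurd ⟨h1, h2⟩ h⟩
  choose g hg using hex
  have hg' : ∀ x ∈ X, ∀ y ∈ X, x ≠ y → LatinOn (g (lineTrace X x y)) (lineTrace X x y) ∧
      ∀ a ∈ lineTrace X x y, g (lineTrace X x y) a a = a := fun x hx y hy hxy =>
    hg _ (card_lineTrace_le X x y) (hX.card_lineTrace_ne hx hy hxy)
  let f : V → V → V := fun x y => if x = y then x else g (lineTrace X x y) x y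
  have hfs : ∀ x, f x x = x := fun x => if_pos rfl
  have hfn : ∀ x y, x ≠ y → f x y = g (lineTrace X x y) x y := fun x y h => if_neg h
  have hmem : ∀ x ∈ X, ∀ y ∈ X, f x y ∈ lineTrace X x y := by
    intro x hx y hy
    by_cases h : x = y
    · subst h
      rw [hfs]
      exact left_mem_lineTrace hx x
    · rw [hfn x y h]
      exact (hg' x hx y hy h).1.mem _ (left_mem_lineTrace hx y) _ (right_mem_lineTrace x hy)
  have hne_left : ∀ x ∈ X, ∀ y ∈ X, x ≠ y → f x y ≠ x := by
    intro x hx y hy h he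
    obtain ⟨hl, hi⟩ := hg' x hx y hy h
    have hxm := left_mem_lineTrace hx y
    rw [hfn x y h] at he
    exact h (hl.left_inj x hxm _ hxm _ (right_mem_lineTrace x hy) ((hi x hxm).trans he.symm))
  have hne_right : ∀ x ∈ X, ∀ y ∈ X, x ≠ y → f x y ≠ y := by
    intro x hx y hy h he
    obtain ⟨hl, hi⟩ := hg' x hx y hy h
    have hym := right_mem_lineTrace x hy
    rw [hfn x y h] at he
    exact h (hl.right_inj x (left_mem_lineTrace hx y) _ hym _ hym (he.trans (hi y hym).symm))
  refine ⟨f, ⟨fun x hx y hy => (mem_lineTrace.1 (hmem x hx y hy)).1, ?_, ?_⟩, hfs,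
    fun x hx y hy => (mem_lineTrace.1 (hmem x hx y hy)).2⟩
  · intro x hx y hy z hz h
    by_cases hxy : x = y
    · subst hxy
      by_contra hxz
      exact hne_left x hx z hz hxz (h.symm.trans (hfs x))
    by_cases hxz : x = z
    · subst hxz
      exact absurd (h.trans (hfs x)) (hne_left x hx y hy hxy)
    -- By idempotency the common value differs from `x`, so it and `x` span both lines. The lines
    -- coincide, and cancellation takes place in a single square.
    have e1 := lineTrace_eq (left_mem_lineTrace hx y) (hmem x hx y hy)
      (hne_left x hx y hy hxy).symm
    have e2 := lineTrace_eq (left_mem_lineTrace hx z) (hmem x hx z hz)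
      (hne_left x hx z hz hxz).symm
    have e : lineTrace X x z = lineTrace X x y := by rw [← e1, ← e2, h]
    have hz' : z ∈ lineTrace X x y := e ▸ right_mem_lineTrace x hz
    rw [hfn x y hxy, hfn x z hxz, e] at h
    exact (hg' x hx y hy hxy).1.left_inj x (left_mem_lineTrace hx y) _
      (right_mem_lineTrace x hy) _ hz' h
  · intro x hx y hy z hz h
    by_cases hxz : x = z
    · subst hxz
      by_contra hxy
      exact hne_right y hy x hx (Ne.symm hxy) (h.symm.trans (hfs x))
    by_cases hyz : y = z
    · subst hyz
      exact absurd (h.trans (hfs y)) (hne_right x hx y hy hxz)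
    have e1 := lineTrace_eq (right_mem_lineTrace x hz) (hmem x hx z hz)
      (hne_right x hx z hz hxz).symm
    have e2 := lineTrace_eq (right_mem_lineTrace y hz) (hmem y hy z hz)
      (hne_right y hy z hz hyz).symm
    have e : lineTrace X y z = lineTrace X x z := by rw [← e1, ← e2, h]
    have hy' : y ∈ lineTrace X x z := e ▸ left_mem_lineTrace hy z
    rw [hfn x z hxz, hfn y z hyz, e] at h
    exact (hg' x hx z hz hxz).1.right_inj x (left_mem_lineTrace hx z) _ hy' _
      (right_mem_lineTrace x hz) h

open Classical in
/-- The points of `X` in the plane (or smaller flat) `p + ⟨u, v⟩`. -/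
noncomputable def planeTrace (X : Finset V) (p u v : V) : Finset V :=
  X.filter fun z => ∃ c : ZMod 7 × ZMod 7, z = p + (c.1 • u + c.2 • v)

theorem mem_planeTrace {X : Finset V} {p u v z : V} :
    z ∈ planeTrace X p u v ↔ z ∈ X ∧ ∃ c : ZMod 7 × ZMod 7, z = p + (c.1 • u + c.2 • v) := by
  classical
  simp [planeTrace]

theorem card_planeTrace_le (X : Finset V) (p u v : V) : (planeTrace X p u v).card ≤ 49 := by
  classical
  have : planeTrace X p u v ⊆ (Finset.univ : Finset (ZMod 7 × ZMod 7)).image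
      fun c => p + (c.1 • u + c.2 • v) := by
    intro z hz
    obtain ⟨-, c, rfl⟩ := mem_planeTrace.1 hz
    exact Finset.mem_image_of_mem _ (Finset.mem_univ c)
  exact (Finset.card_le_card this).trans (Finset.card_image_le.trans (by simp [ZMod.card]))

/-- Any three points of `X` lie in a set of at most `49` points closed under `f`. -/
theorem exists_closed_of_collinear {X : Finset V} {f : V → V → V} (hf : LatinOn f X)
    (hline : ∀ x ∈ X, ∀ y ∈ X, ∃ c : ZMod 7, f x y = x + c • (y - x))
    {i j s : V} (hi : i ∈ X) (hj : j ∈ X) (hs : s ∈ X) :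
    ∃ R ⊆ X, R.card ≤ 49 ∧ (∀ r ∈ R, ∀ c ∈ R, f r c ∈ R) ∧ i ∈ R ∧ j ∈ R ∧ s ∈ R := by
  refine ⟨planeTrace X i (j - i) (s - i), fun z hz => (mem_planeTrace.1 hz).1,
    card_planeTrace_le _ _ _ _, ?_, mem_planeTrace.2 ⟨hi, (0, 0), by simp⟩,
    mem_planeTrace.2 ⟨hj, (1, 0), by simp⟩, mem_planeTrace.2 ⟨hs, (0, 1), by simp⟩⟩
  intro r hr c hc
  obtain ⟨hrX, a, ha⟩ := mem_planeTrace.1 hr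
  obtain ⟨hcX, b, hb⟩ := mem_planeTrace.1 hc
  obtain ⟨t, ht⟩ := hline r hrX c hcX
  refine mem_planeTrace.2 ⟨hf.mem r hrX c hcX, a + t • (b - a), ?_⟩
  rw [ht, ha, hb]
  simp only [Prod.fst_add, Prod.snd_add, Prod.smul_fst, Prod.smul_snd, Prod.fst_sub,
    Prod.snd_sub, smul_eq_mul]
  module

theorem NoTwoSecant.coveredLatin {X : Finset V} (hX : NoTwoSecant X) : CoveredLatin X.card := by
  obtain ⟨f, hf, -, hline⟩ := hX.exists_latinOn
  refine CoveredLatin.of_latinOn f X hf fun i hi j hj s hs => ?_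
  obtain ⟨R, hR, hk, hm, h1, h2, h3⟩ := exists_closed_of_collinear hf hline hi hj hs
  exact ⟨R, R, R, hR, hR, hR, hk.trans (by norm_num), rfl, rfl, hm, h1, h2, h3⟩

end Line

/-! ### Sizes of sets without two-secants -/

/-- `n` is the size of a subset of `(ZMod 7) ^ d` without two-secants. -/
def IsNoTwoSecantSize (d n : ℕ) : Prop :=
  ∃ X : Finset (Fin d → ZMod 7), NoTwoSecant X ∧ X.card = n

theorem NoTwoSecant.map_linearEquiv {V W : Type*} [AddCommGroup V] [Module (ZMod 7) V]
    [AddCommGroup W] [Module (ZMod 7) W] (e : V ≃ₗ[ZMod 7] W) {X : Finset V}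
    (hX : NoTwoSecant X) : NoTwoSecant (X.map e.toEquiv.toEmbedding) := by
  intro x hx y hy hxy
  rw [Finset.mem_map_equiv] at hx hy
  obtain ⟨c, h0, h1, hc⟩ := hX _ hx _ hy (e.toEquiv.symm.injective.ne hxy)
  refine ⟨c, h0, h1, ?_⟩
  rw [Finset.mem_map_equiv]
  have : e.toEquiv.symm (x + c • (y - x)) =
      e.toEquiv.symm x + c • (e.toEquiv.symm y - e.toEquiv.symm x) := by
    change e.symm (x + c • (y - x)) = e.symm x + c • (e.symm y - e.symm x)
    rw [map_add, map_smul, map_sub]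
  rwa [this]

theorem noTwoSecant_univ {V : Type*} [AddCommGroup V] [Module (ZMod 7) V] [Fintype V] :
    NoTwoSecant (Finset.univ : Finset V) :=
  fun _ _ _ _ _ => ⟨2, by decide, by decide, Finset.mem_univ _⟩

/-- Stacking seven parallel slices, three of which are full. -/
theorem NoTwoSecant.stack {V : Type*} [AddCommGroup V] [Module (ZMod 7) V] [Fintype V]
    [DecidableEq V] (Y : ZMod 7 → Finset V) (hY : ∀ a, NoTwoSecant (Y a)) (h0 : Y 0 = Finset.univ)
    (h1 : Y 1 = Finset.univ) (h2 : Y 2 = Finset.univ) :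
    NoTwoSecant (Finset.univ.filter fun p : ZMod 7 × V => p.2 ∈ Y p.1) := by
  rintro ⟨a, v⟩ hx ⟨b, w⟩ hy hxy
  simp only [Finset.mem_filter, Finset.mem_univ, true_and] at hx hy ⊢
  by_cases hab : a = b
  · subst hab
    obtain ⟨c, hc0, hc1, hc⟩ := hY a v hx w hy fun h => hxy (by rw [h])
    exact ⟨c, hc0, hc1, by simpa using hc⟩
  -- A line joining two different slices crosses every slice. One of the three full slices differs
  -- from both, and supplies the third point.
  · obtain ⟨k, hk, hka, hkb⟩ : ∃ k : ZMod 7, Y k = Finset.univ ∧ k ≠ a ∧ k ≠ b := by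
      have : ∀ a b : ZMod 7, (0 ≠ a ∧ 0 ≠ b) ∨ (1 ≠ a ∧ 1 ≠ b) ∨ (2 ≠ a ∧ 2 ≠ b) := by decide
      rcases this a b with h | h | h
      exacts [⟨0, h0, h⟩, ⟨1, h1, h⟩, ⟨2, h2, h⟩]
    have hba : b - a ≠ 0 := sub_ne_zero.2 (Ne.symm hab)
    refine ⟨(k - a) / (b - a), div_ne_zero (sub_ne_zero.2 hka) hba, ?_, ?_⟩
    · rw [Ne, div_eq_one_iff_eq hba]
      exact fun h => hkb (sub_left_injective h)
    · have : a + (k - a) / (b - a) * (b - a) = k := by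
        rw [div_mul_cancel₀ _ hba]
        ring
      simp [this, hk]

theorem IsNoTwoSecantSize.stack {d : ℕ} {n : ZMod 7 → ℕ} (hn : ∀ a, IsNoTwoSecantSize d (n a))
    (h0 : n 0 = 7 ^ d) (h1 : n 1 = 7 ^ d) (h2 : n 2 = 7 ^ d) :
    IsNoTwoSecantSize (d + 1) (∑ a, n a) := by
  classical
  choose Y hY hc using hn
  have full : ∀ a, n a = 7 ^ d → Y a = Finset.univ := fun a ha => by
    rw [← Finset.card_eq_iff_eq_univ, hc, ha]
    simp [ZMod.card]
  have := NoTwoSecant.stack Y hY (full 0 h0) (full 1 h1) (full 2 h2)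
  refine ⟨_, this.map_linearEquiv (Fin.consLinearEquiv (ZMod 7) fun _ => ZMod 7), ?_⟩
  rw [Finset.card_map, Finset.card_filter, Fintype.sum_prod_type]
  refine Finset.sum_congr rfl fun a _ => ?_
  rw [← hc a, ← Finset.card_filter]
  simp

theorem isNoTwoSecantSize_pow (d : ℕ) : IsNoTwoSecantSize d (7 ^ d) :=
  ⟨Finset.univ, noTwoSecant_univ, by simp [ZMod.card]⟩

theorem isNoTwoSecantSize_zero (d : ℕ) : IsNoTwoSecantSize d 0 :=
  ⟨∅, fun x hx => absurd hx (Finset.notMem_empty x), rfl⟩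

theorem IsNoTwoSecantSize.succ {d n : ℕ} (h : IsNoTwoSecantSize d n) :
    IsNoTwoSecantSize (d + 1) n := by
  classical
  obtain ⟨X, hX, rfl⟩ := h
  let e : (Fin d → ZMod 7) ↪ (Fin (d + 1) → ZMod 7) :=
    ⟨fun v => Fin.cons 0 v, fun v w h => (Fin.cons_inj.1 h).2⟩
  have he : ∀ v i, e v i = (Fin.cons 0 v : Fin (d + 1) → ZMod 7) i := fun _ _ => rfl
  refine ⟨X.map e, ?_, by simp⟩
  intro x hx y hy hxy
  obtain ⟨v, hv, rfl⟩ := Finset.mem_map.1 hx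
  obtain ⟨w, hw, rfl⟩ := Finset.mem_map.1 hy
  obtain ⟨c, h0, h1, hc⟩ := hX v hv w hw fun h => hxy (by rw [h])
  refine ⟨c, h0, h1, Finset.mem_map.2 ⟨_, hc, ?_⟩⟩
  ext i
  refine Fin.cases ?_ (fun i => ?_) i <;> simp [he]

/-- `n` is a sum of four sizes of subsets of `(ZMod 7) ^ d` without two-secants. -/
def IsFourSum (d n : ℕ) : Prop :=
  ∃ t : Fin 4 → ℕ, (∀ c, IsNoTwoSecantSize d (t c)) ∧ ∑ c, t c = n

theorem IsFourSum.add_pow {d n : ℕ} (h : IsFourSum d n) :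
    IsNoTwoSecantSize (d + 1) (3 * 7 ^ d + n) := by
  obtain ⟨t, ht, rfl⟩ := h
  have := IsNoTwoSecantSize.stack (d := d)
    (n := (![7 ^ d, 7 ^ d, 7 ^ d, t 0, t 1, t 2, t 3] : Fin 7 → ℕ)) ?_ rfl rfl rfl
  · convert this using 1
    change _ = ∑ a : Fin 7, _
    rw [Fin.sum_univ_four, Fin.sum_univ_seven]
    change _ = 7 ^ d + 7 ^ d + 7 ^ d + t 0 + t 1 + t 2 + t 3
    ring
  · intro a
    change Fin 7 at a
    have hp := isNoTwoSecantSize_pow d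
    fin_cases a
    exacts [hp, hp, hp, ht 0, ht 1, ht 2, ht 3]

/-- With `q = 7 ^ d`, the induction hypothesis yields every size in `[3q, 7q]` one dimension up.
One, two or four such sizes sum to anything in `[3q, 7q]`, `[6q, 14q]` or `[12q, 28q]`. Below `4q`,
the previous decomposition is reused inside a hyperplane. -/
theorem isFourSum_of_le (d : ℕ) : ∀ n ≤ 4 * 7 ^ d, IsFourSum d n := by
  induction d with
  | zero =>
    intro n hn
    have h0 := isNoTwoSecantSize_zero 0
    have h1 := isNoTwoSecantSize_pow 0
    have h : ∀ k ≤ 1, IsNoTwoSecantSize 0 k := fun k hk => by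
      interval_cases k
      exacts [h0, h1]
    refine ⟨fun c => if (c : ℕ) < n then 1 else 0, fun c => h _ (by dsimp only; split_ifs <;> simp), ?_⟩
    have : n ≤ 4 := by simpa using hn
    interval_cases n <;> rfl
  | succ d ih =>
    have hbig : ∀ n, 3 * 7 ^ d ≤ n → n ≤ 7 * 7 ^ d → IsNoTwoSecantSize (d + 1) n := by
      intro n h1 h2
      have := (ih (n - 3 * 7 ^ d) (by omega)).add_pow
      rwa [Nat.add_sub_cancel' h1] at this
    have h0 := isNoTwoSecantSize_zero (d + 1)
    have build : ∀ a b c e : ℕ, IsNoTwoSecantSize (d + 1) a → IsNoTwoSecantSize (d + 1) b →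
        IsNoTwoSecantSize (d + 1) c → IsNoTwoSecantSize (d + 1) e →
        IsFourSum (d + 1) (a + b + c + e) := by
      intro a b c e ha hb hc he
      refine ⟨![a, b, c, e], fun i => ?_, by simp [Fin.sum_univ_four]⟩
      fin_cases i
      exacts [ha, hb, hc, he]
    intro n hn
    rw [pow_succ] at hn
    rcases le_or_gt n (4 * 7 ^ d) with h | h
    · obtain ⟨t, ht, hs⟩ := ih n h
      exact ⟨t, fun c => (ht c).succ, hs⟩
    set q := 7 ^ d
    rcases le_or_gt n (7 * q) with h7 | h7
    · have := build n 0 0 0 (hbig n (by omega) h7) h0 h0 h0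
      simpa using this
    rcases le_or_gt n (14 * q) with h14 | h14
    -- Parts as equal as possible are each at least `3q`, since `n > 7q` here and `n > 14q` in the
    -- four-part case.
    · have := build (n / 2) (n - n / 2) 0 0 (hbig _ (by omega) (by omega))
        (hbig _ (by omega) (by omega)) h0 h0
      rwa [show n / 2 + (n - n / 2) + 0 + 0 = n by omega] at this
    · have := build (n / 4) ((n + 1) / 4) ((n + 2) / 4) ((n + 3) / 4)
        (hbig _ (by omega) (by omega)) (hbig _ (by omega) (by omega))
        (hbig _ (by omega) (by omega)) (hbig _ (by omega) (by omega))
      rwa [show n / 4 + (n + 1) / 4 + (n + 2) / 4 + (n + 3) / 4 = n by omega] at this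

theorem isNoTwoSecantSize_of_le {d n : ℕ} (h1 : 3 * 7 ^ d ≤ n) (h2 : n ≤ 7 ^ (d + 1)) :
    IsNoTwoSecantSize (d + 1) n := by
  have := (isFourSum_of_le d (n - 3 * 7 ^ d) (by rw [pow_succ] at h2; omega)).add_pow
  rwa [Nat.add_sub_cancel' h1] at this

/-! ### The transversal design -/

/-- The coefficients of the linear forms on `V × V` defining a transversal design with seven
groups: rows, columns and symbols (the value `none`, with `ρ` telling the three roles apart) and
four further groups. -/
def formCoeff (ρ : Fin 3) : Option (Fin 4) → ZMod 7 × ZMod 7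
  | none => (![(1, 0), (0, 1), (1, 1)] : Fin 3 → ZMod 7 × ZMod 7) ρ
  | some c => (-((c : ℕ) + 1 : ZMod 7), 1)

/-- The seven forms are distinct points among the eight of the projective line over `ZMod 7`. Only
`none` may be repeated, since it alone changes with the role. -/
theorem formCoeff_det_ne_zero : ∀ ρ σ : Fin 3, ρ ≠ σ → ∀ o p : Option (Fin 4),
    (o = p → o = none) →
    (formCoeff ρ o).1 * (formCoeff σ p).2 - (formCoeff ρ o).2 * (formCoeff σ p).1 ≠ 0 := by
  decide

section Design

variable {V : Type*} [AddCommGroup V] [Module (ZMod 7) V]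

/-- The point of the group `o`, in the role `ρ`, on the block `b`. -/
def blockPoint (ρ : Fin 3) (o : Option (Fin 4)) (b : V × V) : V :=
  (formCoeff ρ o).1 • b.1 + (formCoeff ρ o).2 • b.2

theorem blockPoint_some (ρ σ : Fin 3) (c : Fin 4) (b : V × V) :
    blockPoint ρ (some c) b = blockPoint σ (some c) b := rfl

theorem blockPoint_sub (ρ : Fin 3) (o : Option (Fin 4)) (b b' : V × V) :
    blockPoint ρ o (b - b') = blockPoint ρ o b - blockPoint ρ o b' := by
  simp only [blockPoint, Prod.fst_sub, Prod.snd_sub]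
  module

/-- Cramer's rule modulo `H`. Taking `H = ⊥` makes blocks unique; taking `H` a line makes subdesigns
closed. -/
theorem mem_of_blockPoint_mem (H : Submodule (ZMod 7) V) {ρ σ : Fin 3} (hρσ : ρ ≠ σ)
    {o p : Option (Fin 4)} (hop : o = p → o = none) {b : V × V}
    (h1 : blockPoint ρ o b ∈ H) (h2 : blockPoint σ p b ∈ H) : b.1 ∈ H ∧ b.2 ∈ H := by
  have hd := formCoeff_det_ne_zero ρ σ hρσ o p hop
  constructor
  · rw [← H.smul_mem_iff hd]
    have := H.sub_mem (H.smul_mem (formCoeff σ p).2 h1) (H.smul_mem (formCoeff ρ o).2 h2)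
    convert this using 1
    simp only [blockPoint]
    module
  · rw [← H.smul_mem_iff hd]
    have := H.sub_mem (H.smul_mem (formCoeff ρ o).1 h2) (H.smul_mem (formCoeff σ p).1 h1)
    convert this using 1
    simp only [blockPoint]
    module

theorem blockPoint_mem (H : Submodule (ZMod 7) V) (ρ : Fin 3) (o : Option (Fin 4)) {b : V × V}
    (h : b.1 ∈ H ∧ b.2 ∈ H) : blockPoint ρ o b ∈ H :=
  H.add_mem (H.smul_mem _ h.1) (H.smul_mem _ h.2)

theorem block_unique {ρ σ : Fin 3} (hρσ : ρ ≠ σ) {o p : Option (Fin 4)} (hop : o = p → o = none)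
    {b b' : V × V} (h1 : blockPoint ρ o b = blockPoint ρ o b')
    (h2 : blockPoint σ p b = blockPoint σ p b') : b = b' := by
  have := mem_of_blockPoint_mem ⊥ hρσ hop (b := b - b')
    (by rw [blockPoint_sub, h1, sub_self]; exact zero_mem _)
    (by rw [blockPoint_sub, h2, sub_self]; exact zero_mem _)
  rw [← sub_eq_zero]
  exact Prod.ext ((Submodule.mem_bot _).1 this.1) ((Submodule.mem_bot _).1 this.2)

theorem block_exists {ρ σ : Fin 3} (hρσ : ρ ≠ σ) {o p : Option (Fin 4)} (hop : o = p → o = none)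
    (u v : V) : ∃ b : V × V, blockPoint ρ o b = u ∧ blockPoint σ p b = v := by
  have hd := formCoeff_det_ne_zero ρ σ hρσ o p hop
  simp only [blockPoint]
  generalize formCoeff ρ o = m at hd ⊢
  generalize formCoeff σ p = n at hd ⊢
  refine ⟨((m.1 * n.2 - m.2 * n.1)⁻¹ • (n.2 • u - m.2 • v),
    (m.1 * n.2 - m.2 * n.1)⁻¹ • (m.1 • v - n.1 • u)), ?_, ?_⟩
  · calc _ = ((m.1 * n.2 - m.2 * n.1)⁻¹ * (m.1 * n.2 - m.2 * n.1)) • u := by module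
      _ = u := by rw [inv_mul_cancel₀ hd, one_smul]
  · calc _ = ((m.1 * n.2 - m.2 * n.1)⁻¹ * (m.1 * n.2 - m.2 * n.1)) • v := by module
      _ = v := by rw [inv_mul_cancel₀ hd, one_smul]

end Design

/-- A latin square of any order at most `5` with prescribed idempotents in all but one place. -/
theorem LatinOn.exists_idempotent_some (S : Finset (Option (Fin 4))) :
    ∃ g : Option (Fin 4) → Option (Fin 4) → Option (Fin 4), none ∈ S →
      LatinOn g S ∧ ∀ c, some c ∈ S → g (some c) (some c) = some c := by
  by_cases h2 : S.card = 2
  · by_cases hn : none ∈ S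
    · obtain ⟨a, b, hab, rfl⟩ := Finset.card_eq_two.1 h2
      obtain ⟨c, hc⟩ : ∃ c : Fin 4, ({a, b} : Finset (Option (Fin 4))) = {none, some c} := by
        simp only [Finset.mem_insert, Finset.mem_singleton] at hn
        rcases hn with rfl | rfl
        · obtain ⟨c, rfl⟩ := Option.ne_none_iff_exists'.1 hab.symm
          exact ⟨c, rfl⟩
        · obtain ⟨c, rfl⟩ := Option.ne_none_iff_exists'.1 hab
          exact ⟨c, Finset.pair_comm _ _⟩
      rw [hc]
      -- In order 2 only one symbol can be idempotent, so `some c` fills the whole diagonal. The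
      -- group `none` needs no idempotent, as its three roles are distinct groups of the design.
      refine ⟨fun a b => if a = b then some c else none, fun _ => ⟨⟨?_, ?_, ?_⟩, ?_⟩⟩
      · simp
      · simp
      · simp
      · simp
    · exact ⟨fun a _ => a, fun h => absurd h hn⟩
  · have h7 : S.card ≤ 7 := (Finset.card_le_univ S).trans (by simp)
    obtain ⟨g, hg, hi⟩ := LatinOn.exists_idempotent S h7 h2
    exact ⟨g, fun _ => ⟨hg, fun c hc => hi _ hc⟩⟩

/-! ### Prolongation of the addition table -/

/-- The points of the truncated design, in each of the three roles. -/
def designPoints {V : Type*} [Fintype V] [DecidableEq V]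
    (T : Option (Fin 4) → Finset V) : Finset (Option (Fin 4) × V) :=
  Finset.univ.filter fun p => p.2 ∈ T p.1

theorem mem_designPoints {V : Type*} [Fintype V] [DecidableEq V]
    {T : Option (Fin 4) → Finset V} {p : Option (Fin 4) × V} : p ∈ designPoints T ↔ p.2 ∈ T p.1 := by
  simp [designPoints]

theorem card_designPoints {V : Type*} [Fintype V] [DecidableEq V]
    (T : Option (Fin 4) → Finset V) : (designPoints T).card = ∑ o, (T o).card := by
  rw [designPoints, Finset.card_filter, Fintype.sum_prod_type]
  refine Finset.sum_congr rfl fun o _ => ?_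
  rw [← Finset.card_filter]
  simp

section Prolongation

variable {V : Type*} [AddCommGroup V] [Module (ZMod 7) V] [Fintype V] [DecidableEq V]
  (T : Option (Fin 4) → Finset V) (M : Fin 4 → V → V → V)
  (g : Finset (Option (Fin 4)) → Option (Fin 4) → Option (Fin 4) → Option (Fin 4))

/-- The groups whose truncation `T` contains the point on the block `b`. -/
def blockGroups (b : V × V) : Finset (Option (Fin 4)) :=
  Finset.univ.filter fun o => blockPoint 0 o b ∈ T o

/-- Row `p`, column `q` and symbol `s` lie in a common block, or in a common truncated group. -/
def DesignRel (p q s : Option (Fin 4) × V) : Prop :=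
  (∃ (c : Fin 4) (u v : V), u ∈ T (some c) ∧ v ∈ T (some c) ∧
      p = (some c, u) ∧ q = (some c, v) ∧ s = (some c, M c u v)) ∨
    ∃ (b : V × V) (o o' : Option (Fin 4)), o ∈ blockGroups T b ∧ o' ∈ blockGroups T b ∧
      (o = o' → o = none) ∧ p = (o, blockPoint 0 o b) ∧ q = (o', blockPoint 1 o' b) ∧
      s = (g (blockGroups T b) o o', blockPoint 2 (g (blockGroups T b) o o') b)

variable {T M g}

theorem mem_blockGroups (hT : T none = Finset.univ) (ρ : Fin 3) {b : V × V}
    {o : Option (Fin 4)} : o ∈ blockGroups T b ↔ blockPoint ρ o b ∈ T o := by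
  cases o with
  | none => simp [blockGroups, hT]
  | some c => simp [blockGroups, blockPoint_some ρ 0]

theorem exists_designRel (hT : T none = Finset.univ) {p q : Option (Fin 4) × V}
    (hp : p ∈ designPoints T) (hq : q ∈ designPoints T) : ∃ s, DesignRel T M g p q s := by
  obtain ⟨o, u⟩ := p
  obtain ⟨o', v⟩ := q
  rw [mem_designPoints] at hp hq
  by_cases h : o = o' → o = none
  · obtain ⟨b, rfl, rfl⟩ := block_exists (by decide : (0 : Fin 3) ≠ 1) h u v
    exact ⟨_, Or.inr ⟨b, o, o', (mem_blockGroups hT 0).2 hp, (mem_blockGroups hT 1).2 hq, h, rfl,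
      rfl, rfl⟩⟩
  · obtain ⟨rfl, hn⟩ := Classical.not_imp.1 h
    obtain ⟨c, rfl⟩ := Option.ne_none_iff_exists'.1 hn
    exact ⟨_, Or.inl ⟨c, u, v, hp, hq, rfl, rfl, rfl⟩⟩

theorem latinOn_blockGroups (hT : T none = Finset.univ)
    (hg : ∀ S, none ∈ S → LatinOn (g S) S ∧ ∀ c, some c ∈ S → g S (some c) (some c) = some c)
    (b : V × V) : LatinOn (g (blockGroups T b)) (blockGroups T b) ∧
      ∀ c, some c ∈ blockGroups T b → g (blockGroups T b) (some c) (some c) = some c :=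
  hg _ (by simp [blockGroups, hT])

theorem mem_of_designRel (hT : T none = Finset.univ) (hM : ∀ c, LatinOn (M c) (T (some c)))
    (hg : ∀ S, none ∈ S → LatinOn (g S) S ∧ ∀ c, some c ∈ S → g S (some c) (some c) = some c)
    {p q s : Option (Fin 4) × V} (h : DesignRel T M g p q s) : s ∈ designPoints T := by
  rw [mem_designPoints]
  rcases h with ⟨c, u, v, hu, hv, -, -, rfl⟩ | ⟨b, o, o', ho, ho', -, -, -, rfl⟩
  · exact (hM c).mem u hu v hv
  · exact (mem_blockGroups hT 2).1 ((latinOn_blockGroups hT hg b).1.mem _ ho _ ho')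

end Prolongation

section Prolongation

variable {V : Type*} [AddCommGroup V] [Module (ZMod 7) V] [Fintype V] [DecidableEq V]
  {T : Option (Fin 4) → Finset V} {M : Fin 4 → V → V → V}
  {g : Finset (Option (Fin 4)) → Option (Fin 4) → Option (Fin 4) → Option (Fin 4)}

/-- If row and symbol shared a group `some c`, idempotency and cancellation would put the column
there too, a cell reserved for `M c`. So row and symbol determine the block. -/
theorem ne_blockSquare_left (hT : T none = Finset.univ)
    (hg : ∀ S, none ∈ S → LatinOn (g S) S ∧ ∀ c, some c ∈ S → g S (some c) (some c) = some c)
    {b : V × V} {o o' : Option (Fin 4)} (ho : o ∈ blockGroups T b) (ho' : o' ∈ blockGroups T b)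
    (h : o = o' → o = none) (he : o = g (blockGroups T b) o o') : o = none := by
  obtain ⟨hl, hi⟩ := latinOn_blockGroups hT hg b
  cases o with
  | none => rfl
  | some c => exact h (hl.left_inj _ ho _ ho _ ho' ((hi c ho).trans he))

theorem ne_blockSquare_right (hT : T none = Finset.univ)
    (hg : ∀ S, none ∈ S → LatinOn (g S) S ∧ ∀ c, some c ∈ S → g S (some c) (some c) = some c)
    {b : V × V} {o o' : Option (Fin 4)} (ho : o ∈ blockGroups T b) (ho' : o' ∈ blockGroups T b)
    (h : o = o' → o = none) (he : o' = g (blockGroups T b) o o') : o' = none := by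
  obtain ⟨hl, hi⟩ := latinOn_blockGroups hT hg b
  cases o' with
  | none => rfl
  | some c =>
    have := hl.right_inj _ ho _ ho' _ ho' (he.symm.trans (hi c ho').symm)
    exact this ▸ h this

theorem designRel_left_inj (hT : T none = Finset.univ) (hM : ∀ c, LatinOn (M c) (T (some c)))
    (hg : ∀ S, none ∈ S → LatinOn (g S) S ∧ ∀ c, some c ∈ S → g S (some c) (some c) = some c)
    {p q q' s : Option (Fin 4) × V} (h : DesignRel T M g p q s) (h' : DesignRel T M g p q' s) :
    q = q' := by
  -- A cell filled by `M c` has row and symbol in one adjoined group; a cell filled from a block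
  -- never does.
  have mixed : ∀ (c : Fin 4) (u w : V) (b : V × V) (o o' : Option (Fin 4)),
      o ∈ blockGroups T b → o' ∈ blockGroups T b → (o = o' → o = none) →
      (some c, u) = (o, blockPoint 0 o b) →
      (some c, w) = (g (blockGroups T b) o o', blockPoint 2 (g (blockGroups T b) o o') b) →
      False := by
    intro c u w b o o' ho ho' h h1 h2
    have e1 := (Prod.mk.inj h1).1
    have e2 := (Prod.mk.inj h2).1
    have := ne_blockSquare_left hT hg ho ho' h (e1.symm.trans e2)
    simp [← e1] at this
  rcases h with ⟨c, u, v, hu, hv, hp, rfl, hs⟩ | ⟨b, o, r, ho, hr, hor, hp, rfl, hs⟩ <;>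
  rcases h' with ⟨c', u', v', hu', hv', hp', rfl, hs'⟩ |
    ⟨b', o', r', ho', hr', hor', hp', rfl, hs'⟩
  · obtain ⟨h1, rfl⟩ := Prod.mk.inj (hp.symm.trans hp')
    obtain rfl := Option.some.inj h1
    rw [(hM c).left_inj u hu v hv v' hv' (Prod.mk.inj (hs.symm.trans hs')).2]
  · exact (mixed _ _ _ _ _ _ ho' hr' hor' (hp.symm.trans hp') (hs.symm.trans hs')).elim
  · exact (mixed _ _ _ _ _ _ ho hr hor (hp'.symm.trans hp) (hs'.symm.trans hs)).elim
  · obtain ⟨rfl, h1⟩ := Prod.mk.inj (hp.symm.trans hp')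
    obtain ⟨h2, h3⟩ := Prod.mk.inj (hs.symm.trans hs')
    rw [← h2] at h3
    obtain rfl := block_unique (by decide : (0 : Fin 3) ≠ 2)
      (ne_blockSquare_left hT hg ho hr hor) h1 h3
    rw [(latinOn_blockGroups hT hg b).1.left_inj _ ho _ hr _ hr' h2]

theorem designRel_right_inj (hT : T none = Finset.univ) (hM : ∀ c, LatinOn (M c) (T (some c)))
    (hg : ∀ S, none ∈ S → LatinOn (g S) S ∧ ∀ c, some c ∈ S → g S (some c) (some c) = some c)
    {p p' q s : Option (Fin 4) × V} (h : DesignRel T M g p q s) (h' : DesignRel T M g p' q s) :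
    p = p' := by
  have mixed : ∀ (c : Fin 4) (u w : V) (b : V × V) (o o' : Option (Fin 4)),
      o ∈ blockGroups T b → o' ∈ blockGroups T b → (o = o' → o = none) →
      (some c, u) = (o', blockPoint 1 o' b) →
      (some c, w) = (g (blockGroups T b) o o', blockPoint 2 (g (blockGroups T b) o o') b) →
      False := by
    intro c u w b o o' ho ho' h h1 h2
    have e1 := (Prod.mk.inj h1).1
    have e2 := (Prod.mk.inj h2).1
    have := ne_blockSquare_right hT hg ho ho' h (e1.symm.trans e2)
    simp [← e1] at this
  rcases h with ⟨c, u, v, hu, hv, rfl, hq, hs⟩ | ⟨b, o, r, ho, hr, hor, rfl, hq, hs⟩ <;>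
  rcases h' with ⟨c', u', v', hu', hv', rfl, hq', hs'⟩ |
    ⟨b', o', r', ho', hr', hor', rfl, hq', hs'⟩
  · obtain ⟨h1, rfl⟩ := Prod.mk.inj (hq.symm.trans hq')
    obtain rfl := Option.some.inj h1
    rw [(hM c).right_inj u hu u' hu' v hv (Prod.mk.inj (hs.symm.trans hs')).2]
  · exact (mixed _ _ _ _ _ _ ho' hr' hor' (hq.symm.trans hq') (hs.symm.trans hs')).elim
  · exact (mixed _ _ _ _ _ _ ho hr hor (hq'.symm.trans hq) (hs'.symm.trans hs)).elim
  · obtain ⟨rfl, h1⟩ := Prod.mk.inj (hq.symm.trans hq')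
    obtain ⟨h2, h3⟩ := Prod.mk.inj (hs.symm.trans hs')
    rw [← h2] at h3
    obtain rfl := block_unique (by decide : (1 : Fin 3) ≠ 2)
      (ne_blockSquare_right hT hg ho hr hor) h1 h3
    rw [(latinOn_blockGroups hT hg b).1.right_inj _ ho _ ho' _ hr h2]

/-! ### Small subdesigns -/

open Classical in
/-- The points, in the role `ρ`, of the subdesign through the block `b` in the direction `h`. -/
noncomputable def subPoints (T : Option (Fin 4) → Finset V) (b : V × V) (h : V) (ρ : Fin 3) :
    Finset (Option (Fin 4) × V) :=
  (designPoints T).filter fun p => p.2 - blockPoint ρ p.1 b ∈ Submodule.span (ZMod 7) {h}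

theorem mem_subPoints {b : V × V} {h : V} {ρ : Fin 3} {p : Option (Fin 4) × V} :
    p ∈ subPoints T b h ρ ↔
      p.2 ∈ T p.1 ∧ p.2 - blockPoint ρ p.1 b ∈ Submodule.span (ZMod 7) {h} := by
  classical
  rw [subPoints, Finset.mem_filter, mem_designPoints]

/-- Translation group by group carries one role to another; on the adjoined groups it is the
identity, so it respects the truncation. -/
theorem card_subPoints_le_card (hT : T none = Finset.univ) (b : V × V) (h : V) (ρ σ : Fin 3) :
    (subPoints T b h ρ).card ≤ (subPoints T b h σ).card := by
  refine Finset.card_le_card_of_injOn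
    (fun p => (p.1, p.2 - blockPoint ρ p.1 b + blockPoint σ p.1 b)) ?_ ?_
  · rintro ⟨o, v⟩ hp
    rw [Finset.mem_coe, mem_subPoints] at hp ⊢
    refine ⟨?_, by simpa using hp.2⟩
    cases o with
    | none => simp [hT]
    | some c => simpa [blockPoint_some ρ σ] using hp.1
  · rintro ⟨o, v⟩ - ⟨o', v'⟩ - he
    obtain ⟨rfl, h2⟩ := Prod.mk.inj he
    simpa using h2

theorem card_subPoints_le (T : Option (Fin 4) → Finset V) (b : V × V) (h : V) (ρ : Fin 3) : (subPoints T b h ρ).card ≤ 35 := by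
  have : subPoints T b h ρ ⊆ (Finset.univ : Finset (Option (Fin 4) × ZMod 7)).image
      fun p => (p.1, blockPoint ρ p.1 b + p.2 • h) := by
    rintro ⟨o, v⟩ hp
    obtain ⟨a, ha⟩ := Submodule.mem_span_singleton.1 (mem_subPoints.1 hp).2
    refine Finset.mem_image.2 ⟨(o, a), Finset.mem_univ _, ?_⟩
    simp only [ha, add_sub_cancel]
  exact (Finset.card_le_card this).trans (Finset.card_image_le.trans (by simp [ZMod.card]))

/-- Modulo the line `H`, a block whose row and column agree with those of `b` agrees with `b`, hence
so does its symbol. Inside an adjoined group, `M c` stays on the line through its arguments. -/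
theorem subPoints_closed (hT : T none = Finset.univ) (hM : ∀ c, LatinOn (M c) (T (some c)))
    (hline : ∀ c, ∀ x ∈ T (some c), ∀ y ∈ T (some c), ∃ t : ZMod 7, M c x y = x + t • (y - x))
    (hg : ∀ S, none ∈ S → LatinOn (g S) S ∧ ∀ c, some c ∈ S → g S (some c) (some c) = some c)
    {b : V × V} {h : V} {p q s : Option (Fin 4) × V} (hp : p ∈ subPoints T b h 0)
    (hq : q ∈ subPoints T b h 1) (hr : DesignRel T M g p q s) : s ∈ subPoints T b h 2 := by
  rw [mem_subPoints] at hp hq ⊢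
  refine ⟨mem_designPoints.1 (mem_of_designRel hT hM hg hr), ?_⟩
  set H := Submodule.span (ZMod 7) {h}
  rcases hr with ⟨c, u, v, hu, hv, rfl, rfl, rfl⟩ | ⟨b', o, o', -, -, hoo, rfl, rfl, rfl⟩
  · obtain ⟨t, ht⟩ := hline c u hu v hv
    have := H.add_mem hp.2 (H.smul_mem t (H.sub_mem hq.2 hp.2))
    rw [blockPoint_some 1 2, blockPoint_some 0 2] at this
    convert this using 1
    simp only [ht]
    module
  · have h1 := hp.2
    have h2 := hq.2
    simp only [← blockPoint_sub] at h1 h2 ⊢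
    exact blockPoint_mem H _ _ (mem_of_blockPoint_mem H (by decide) hoo h1 h2)

/-- Take `b` to be the block joining `p` and `q`, and `h` the displacement of `r` from that block.
-/
theorem exists_mem_subPoints {ρ σ : Fin 3} (hρσ : ρ ≠ σ) (τ : Fin 3)
    {p q r : Option (Fin 4) × V} (hp : p ∈ designPoints T) (hq : q ∈ designPoints T)
    (hr : r ∈ designPoints T) (hpq : p.1 = q.1 → p.1 = none) :
    ∃ (b : V × V) (h : V), p ∈ subPoints T b h ρ ∧ q ∈ subPoints T b h σ ∧
      r ∈ subPoints T b h τ := by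
  rw [mem_designPoints] at hp hq hr
  obtain ⟨b, h1, h2⟩ := block_exists hρσ hpq p.2 q.2
  refine ⟨b, r.2 - blockPoint τ r.1 b, mem_subPoints.2 ⟨hp, ?_⟩, mem_subPoints.2 ⟨hq, ?_⟩,
    mem_subPoints.2 ⟨hr, Submodule.mem_span_singleton_self _⟩⟩
  · rw [h1, sub_self]
    exact zero_mem _
  · rw [h2, sub_self]
    exact zero_mem _

/-- Adjoining four sets without two-secants to the addition table of `V`. -/
theorem coveredLatin_add (X : Fin 4 → Finset V) (hX : ∀ c, NoTwoSecant (X c)) :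
    CoveredLatin (Fintype.card V + ∑ c, (X c).card) := by
  classical
  choose M hM hid hline using fun c => (hX c).exists_latinOn
  choose g hg using LatinOn.exists_idempotent_some
  let T : Option (Fin 4) → Finset V := fun o => o.elim Finset.univ X
  have hT : T none = Finset.univ := rfl
  have hM' : ∀ c, LatinOn (M c) (T (some c)) := hM
  have hcard : (designPoints T).card = Fintype.card V + ∑ c, (X c).card := by
    rw [card_designPoints, Fintype.sum_option]
    rfl
  have hex : ∀ p q, ∃ s, p ∈ designPoints T → q ∈ designPoints T → DesignRel T M g p q s := by
    intro p q
    by_cases h : p ∈ designPoints T ∧ q ∈ designPoints T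
    · obtain ⟨s, hs⟩ := exists_designRel (M := M) (g := g) hT h.1 h.2
      exact ⟨s, fun _ _ => hs⟩
    · exact ⟨p, fun h1 h2 => absurd ⟨h1, h2⟩ h⟩
  choose f hf using hex
  have hrel : ∀ {p q s}, p ∈ designPoints T → q ∈ designPoints T → f p q = s →
      DesignRel T M g p q s := fun hp hq h => h ▸ hf _ _ hp hq
  rw [← hcard]
  refine CoveredLatin.of_latinOn f _ ⟨fun p hp q hq => mem_of_designRel hT hM' hg (hf p q hp hq),
    fun p hp q hq q' hq' h =>
      designRel_left_inj hT hM' hg (hrel hp hq h) (hf p q' hp hq'),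
    fun p hp p' hp' q hq h =>
      designRel_right_inj hT hM' hg (hrel hp hq h) (hf p' q hp' hq)⟩ ?_
  intro i hi j hj s hs
  -- Unless all three lie in one adjoined group, `i` shares a block with `j` or with `s`, and a
  -- subdesign through that block catches the third.
  by_cases hall : i.1 = j.1 ∧ i.1 = s.1 ∧ i.1 ≠ none
  · obtain ⟨o, u⟩ := i
    obtain ⟨o', v⟩ := j
    obtain ⟨o'', w⟩ := s
    obtain ⟨rfl, rfl, hn⟩ := hall
    obtain ⟨c, rfl⟩ := Option.ne_none_iff_exists'.1 hn
    rw [mem_designPoints] at hi hj hs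
    obtain ⟨R, hR, hk, hm, h1, h2, h3⟩ :=
      exists_closed_of_collinear (hM c) (hline c) hi hj hs
    let e : V ↪ Option (Fin 4) × V := ⟨fun v => (some c, v), fun _ _ h => (Prod.mk.inj h).2⟩
    have hsub : R.map e ⊆ designPoints T := by
      intro p hp
      obtain ⟨x, hx, rfl⟩ := Finset.mem_map.1 hp
      exact mem_designPoints.2 (hR hx)
    refine ⟨R.map e, R.map e, R.map e, hsub, hsub, hsub, ?_, rfl, rfl, ?_,
      Finset.mem_map_of_mem e h1, Finset.mem_map_of_mem e h2, Finset.mem_map_of_mem e h3⟩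
    · rw [Finset.card_map]
      omega
    · intro p hp q hq
      have hr := hf p q (hsub hp) (hsub hq)
      obtain ⟨x, hx, rfl⟩ := Finset.mem_map.1 hp
      obtain ⟨y, hy, rfl⟩ := Finset.mem_map.1 hq
      rcases hr with ⟨c', x', y', -, -, h1, h2, h3⟩ | ⟨b, o, o', -, -, hoo, h1, h2, -⟩
      · obtain ⟨hc, rfl⟩ := Prod.mk.inj h1
        obtain ⟨-, rfl⟩ := Prod.mk.inj h2
        obtain rfl := Option.some.inj hc
        rw [h3]
        exact Finset.mem_map_of_mem e (hm x hx y hy)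
      · have e1 : some c = o := (Prod.mk.inj h1).1
        have e2 : some c = o' := (Prod.mk.inj h2).1
        have := hoo (e1.symm.trans e2)
        simp [← e1] at this
  · obtain ⟨b, h, h1, h2, h3⟩ : ∃ (b : V × V) (h : V), i ∈ subPoints T b h 0 ∧
        j ∈ subPoints T b h 1 ∧ s ∈ subPoints T b h 2 := by
      by_cases hij : i.1 = j.1 → i.1 = none
      · exact exists_mem_subPoints (by decide) 2 hi hj hs hij
      · have his : i.1 = s.1 → i.1 = none := by
          intro h
          by_contra hn
          exact hij fun h' => absurd ⟨h', h, hn⟩ hall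
        obtain ⟨b, h, h1, h3, h2⟩ :=
          exists_mem_subPoints (by decide : (0 : Fin 3) ≠ 2) 1 hi hs hj his
        exact ⟨b, h, h1, h2, h3⟩
    have hle : ∀ ρ, subPoints T b h ρ ⊆ designPoints T := fun ρ p hp =>
      mem_designPoints.2 (mem_subPoints.1 hp).1
    have hcd : ∀ ρ, (subPoints T b h ρ).card = (subPoints T b h 0).card := fun ρ =>
      le_antisymm (card_subPoints_le_card hT b h ρ 0) (card_subPoints_le_card hT b h 0 ρ)
    exact ⟨_, _, _, hle 0, hle 1, hle 2, (card_subPoints_le T b h 0).trans (by norm_num), hcd 1,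
      hcd 2, fun r hr c hc => subPoints_closed hT hM' hline hg hr hc
        (hf r c (hle 0 hr) (hle 1 hc)), h1, h2, h3⟩

end Prolongation

theorem mainTheorem3 (n : ℕ) (hn : 0 < n) :
    ∃ L : Fin n → Fin n → Fin n, IsLatinSquare L ∧
      ∀ i j s : Fin n, ∃ (k : ℕ) (R C S : Finset (Fin n)),
        k ≤ 94 ∧ IsLatinSubsquare L k R C S ∧ i ∈ R ∧ j ∈ C ∧ s ∈ S := by
  change CoveredLatin n
  have h1 : 7 ^ Nat.log 7 n ≤ n := Nat.pow_log_le_self 7 hn.ne'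
  have h2 : n < 7 ^ (Nat.log 7 n + 1) := Nat.lt_pow_succ_log_self (by norm_num) n
  generalize Nat.log 7 n = d at h1 h2
  rcases le_or_gt (3 * 7 ^ d) n with h | h
  · obtain ⟨X, hX, rfl⟩ := isNoTwoSecantSize_of_le h h2.le
    exact hX.coveredLatin
  -- Here `n - 7 ^ d < 2 * 7 ^ d`, well within reach of four summands.
  · obtain ⟨t, ht, hs⟩ := isFourSum_of_le d (n - 7 ^ d) (by omega)
    choose X hX hc using ht
    have := coveredLatin_add X hX
    simp only [hc, hs] at this
    rw [Fintype.card_fun, ZMod.card, Fintype.card_fin, Nat.add_sub_cancel' h1] at this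
    exact this
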